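/- Let $\widetilde G$ be the Bargmann group, i.e. the set of $g=(\theta,\tau,\mathbf a,\mathbf v,R)\in\mathbb R\times\mathbb R\times\mathbb R^3\times\mathbb R^3\times SO(3)$ with the product topology and the multiplication $$(\theta_1,\tau_1,\mathbf a_1,\mathbf v_1,R_1)(\theta_2,\tau_2,\mathbf a_2,\mathbf v_2,R_2)=\bigl(\theta_1+\theta_2+\mathbf v_1\cdot R_1\mathbf a_2+\tfrac12|\mathbf v_1|^2\tau_2,\ \tau_1+\tau_2,\ R_1\mathbf a_2+\tau_2\mathbf v_1+\mathbf a_1,\ R_1\mathbf v_2+\mathbf v_1,\ R_1R_2\bigr);$$ it is the central extension by $\mathbb R$ of the Galilei group acting on Newtonian spacetime by $(\mathbf x,t)\mapsto(R\mathbf x+t\mathbf v+\mathbf a,\,t+\tau)$. Let $U$ be a strongly continuous unitary representation of $\widetilde G$ on a complex Hilbert space $\mathcal H$. Let $\hat H$ be the generator of the time translations, $U(0,\tau,0,0,1)=e^{i\tau\hat H}$, and let the mass operator $\hat M$ be the generator of the central subgroup, $U(\theta,0,0,0,1)=e^{i\theta\hat M}$. For $M\in\mathbb R$ let $\mathcal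 H_M=\{\psi\in\mathrm{dom}\,\hat M:\hat M\psi=M\psi\}$ be the mass sector of mass $M$, and assume that $\mathcal H=\bigoplus_{M\in\mathbb R}\mathcal H_M$ (Hilbert direct sum). If $\sigma(\hat H)\subseteq[0,\infty)$, then $\sigma(\hat M)\subseteq[0,\infty)$ and $\mathcal H_M=\{0\}$ for every $M<0$. The two conclusions are equivalent: whether or not $\sigma(\hat H)\subseteq[0,\infty)$, one has $\sigma(\hat M)\subseteq[0,\infty)$ if and only if $\mathcal H_M=\{0\}$ for every $M<0$. -/

import Mathlib

open scoped Matrix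

/-- Elements of the Bargmann group (the central extension by `ℝ` of the Galilei group of
`3 + 1`-dimensional Newtonian spacetime). The element `g = (θ, τ, a, v, R)` lies over the Galilei
transformation `(x, t) ↦ (R x + t v + a, t + τ)`, and `θ` is the central coordinate. -/
@[ext]
structure BargmannGroup where
  /-- the central coordinate `θ` -/
  phase : ℝ
  /-- the time translation `τ` -/
  time : ℝ
  /-- the spatial translation `a` -/
  trans : Fin 3 → ℝ
  /-- the boost velocity `v` -/
  boost : Fin 3 → ℝ
  /-- the rotation `R` -/
  rot : Matrix.specialOrthogonalGroup (Fin 3) ℝ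

namespace BargmannGroup

/-- The action of (the Galilei transformation underlying) `g` on spacetime points `(x, t)`. -/
def act (g : BargmannGroup) (p : (Fin 3 → ℝ) × ℝ) : (Fin 3 → ℝ) × ℝ :=
  (g.rot.1 *ᵥ p.1 + p.2 • g.boost + g.trans, p.2 + g.time)

/-- The Galilei group law together with the Bargmann cocycle
`v₁ · R₁ a₂ + |v₁|² τ₂ / 2` in the central coordinate. -/
noncomputable instance : Mul BargmannGroup where
  mul g h :=
    { phase := g.phase + h.phase + g.boost ⬝ᵥ (g.rot.1 *ᵥ h.trans)
        + (1 / 2) * (g.boost ⬝ᵥ g.boost) * h.time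
      time := g.time + h.time
      trans := g.rot.1 *ᵥ h.trans + h.time • g.boost + g.trans
      boost := g.rot.1 *ᵥ h.boost + g.boost
      rot := g.rot * h.rot }

instance : One BargmannGroup where
  one := { phase := 0, time := 0, trans := 0, boost := 0, rot := 1 }

noncomputable instance : Inv BargmannGroup where
  inv g :=
    { phase := -g.phase + g.boost ⬝ᵥ g.trans - (1 / 2) * (g.boost ⬝ᵥ g.boost) * g.time
      time := -g.time
      trans := (g.rot⁻¹).1 *ᵥ (g.time • g.boost - g.trans)
      boost := -((g.rot⁻¹).1 *ᵥ g.boost)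
      rot := g.rot⁻¹ }

theorem mul_def (g h : BargmannGroup) : g * h =
    { phase := g.phase + h.phase + g.boost ⬝ᵥ (g.rot.1 *ᵥ h.trans)
        + (1 / 2) * (g.boost ⬝ᵥ g.boost) * h.time
      time := g.time + h.time
      trans := g.rot.1 *ᵥ h.trans + h.time • g.boost + g.trans
      boost := g.rot.1 *ᵥ h.boost + g.boost
      rot := g.rot * h.rot } := rfl

theorem one_def :
    (1 : BargmannGroup) = { phase := 0, time := 0, trans := 0, boost := 0, rot := 1 } := rfl

theorem inv_def (g : BargmannGroup) : g⁻¹ =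
    { phase := -g.phase + g.boost ⬝ᵥ g.trans - (1 / 2) * (g.boost ⬝ᵥ g.boost) * g.time
      time := -g.time
      trans := (g.rot⁻¹).1 *ᵥ (g.time • g.boost - g.trans)
      boost := -((g.rot⁻¹).1 *ᵥ g.boost)
      rot := g.rot⁻¹ } := rfl

theorem rot_dotProduct (R : Matrix.specialOrthogonalGroup (Fin 3) ℝ) (x y : Fin 3 → ℝ) :
    (R.1 *ᵥ x) ⬝ᵥ (R.1 *ᵥ y) = x ⬝ᵥ y := by
  have h : R.1ᵀ * R.1 = 1 :=
    (Matrix.mem_orthogonalGroup_iff' (Fin 3) ℝ).1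
      (Matrix.mem_specialOrthogonalGroup_iff.1 R.2).1
  rw [Matrix.dotProduct_mulVec, Matrix.vecMul_mulVec, h, Matrix.vecMul_one]

theorem rot_inv_mulVec (R : Matrix.specialOrthogonalGroup (Fin 3) ℝ) (x : Fin 3 → ℝ) :
    (R⁻¹).1 *ᵥ (R.1 *ᵥ x) = x := by
  have h : (R⁻¹).1 * R.1 = 1 := congrArg Subtype.val (inv_mul_cancel R)
  rw [Matrix.mulVec_mulVec, h, Matrix.one_mulVec]

noncomputable instance : Group BargmannGroup where
  mul_assoc f g h := by
    simp only [mul_def]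
    ext1
    · simp only [Matrix.mulVec_add, Matrix.mulVec_smul, dotProduct_add, add_dotProduct,
        dotProduct_smul, smul_eq_mul, Submonoid.coe_mul, ← Matrix.mulVec_mulVec, rot_dotProduct,
        dotProduct_comm _ f.boost]
      ring
    · simp only [add_assoc]
    · simp only [Matrix.mulVec_add, Matrix.mulVec_smul, Submonoid.coe_mul,
        ← Matrix.mulVec_mulVec, smul_add, add_smul]
      abel
    · simp only [Matrix.mulVec_add, Submonoid.coe_mul, ← Matrix.mulVec_mulVec, add_assoc]
    · simp only [mul_assoc]
  one_mul g := by simp [mul_def, one_def]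
  mul_one g := by simp [mul_def, one_def]
  inv_mul_cancel g := by
    simp only [mul_def, one_def, inv_def]
    ext1
    · simp only [neg_dotProduct, dotProduct_neg, rot_dotProduct]
      ring
    · simp
    · simp only [Matrix.mulVec_sub, Matrix.mulVec_smul, smul_neg]
      abel
    · simp
    · simp

/-- The product topology on `ℝ × ℝ × ℝ³ × ℝ³ × SO(3)`. -/
instance : TopologicalSpace BargmannGroup :=
  TopologicalSpace.induced (fun g => (g.phase, g.time, g.trans, g.boost, g.rot)) inferInstance

/-- The central one-parameter subgroup. -/
def central (θ : ℝ) : BargmannGroup :=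
  { phase := θ, time := 0, trans := 0, boost := 0, rot := 1 }

/-- The time-translation subgroup. -/
def timeTranslation (τ : ℝ) : BargmannGroup :=
  { phase := 0, time := τ, trans := 0, boost := 0, rot := 1 }

/-- The multiplication covers the composition of Galilei transformations. -/
theorem act_mul (g h : BargmannGroup) (p : (Fin 3 → ℝ) × ℝ) :
    (g * h).act p = g.act (h.act p) := by
  simp only [act, mul_def]
  ext1
  · simp only [Matrix.mulVec_add, Matrix.mulVec_smul, Submonoid.coe_mul,
      ← Matrix.mulVec_mulVec, smul_add, add_smul]
    abel
  · simp only
    ring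

/-- The kernel of the map onto the Galilei group is the central subgroup. -/
theorem act_eq_id_iff (g : BargmannGroup) : (∀ p, g.act p = p) ↔ ∃ θ, g = central θ := by
  constructor
  · intro h
    have h0 := h (0, 0)
    have h1 := h (0, 1)
    simp only [act, Matrix.mulVec_zero, Prod.mk.injEq] at h0 h1
    have ha : g.trans = 0 := by simpa using h0.1
    have ht : g.time = 0 := by simpa using h0.2
    have hv : g.boost = 0 := by simpa [ha] using h1.1
    refine ⟨g.phase, BargmannGroup.ext rfl ht ha hv (Subtype.ext ?_)⟩
    refine Matrix.ext_of_mulVec_single fun i => ?_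
    have hi := congrArg Prod.fst (h (Pi.single i 1, 0))
    simpa [act, ha, central] using hi.trans (Matrix.one_mulVec _).symm
  · rintro ⟨θ, rfl⟩ p
    simp [act, central]

theorem central_mul_comm (θ : ℝ) (g : BargmannGroup) : central θ * g = g * central θ := by
  simp [central, mul_def, add_comm]

end BargmannGroup

noncomputable section

variable {H : Type*} [NormedAddCommGroup H] [InnerProductSpace ℂ H]

/-- The infinitesimal generator `A` of a one-parameter family `u t = exp (i t A)`: its domain
consists of the vectors `ψ` for which `t ↦ u t ψ` is differentiable at `0`, and
`A ψ = -i (d/dt) (u t ψ)` at `t = 0`. -/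
def infinitesimalGenerator (u : ℝ → H →L[ℂ] H) : H →ₗ.[ℂ] H where
  domain :=
    { carrier := {ψ | DifferentiableAt ℝ (fun t => u t ψ) 0}
      add_mem' := fun {x y} hx hy => by
        simpa only [Set.mem_ofPred_eq, map_add] using
          (show DifferentiableAt ℝ (fun t => u t x) 0 from hx).fun_add hy
      zero_mem' := by simp
      smul_mem' := fun c x hx => by
        simpa only [Set.mem_ofPred_eq, map_smul] using
          (show DifferentiableAt ℝ (fun t => u t x) 0 from hx).fun_const_smul c }
  toFun :=
    { toFun := fun ψ => -Complex.I • deriv (fun t => u t (ψ : H)) 0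
      map_add' := fun x y => by
        have hx : DifferentiableAt ℝ (fun t => u t (x : H)) 0 := x.2
        have hy : DifferentiableAt ℝ (fun t => u t (y : H)) 0 := y.2
        simp only [Submodule.coe_add, map_add, ← smul_add]
        rw [deriv_fun_add hx hy]
      map_smul' := fun c x => by
        have hx : DifferentiableAt ℝ (fun t => u t (x : H)) 0 := x.2
        simp only [Submodule.coe_smul, map_smul, RingHom.id_apply]
        rw [deriv_fun_const_smul c hx, smul_comm] }

/-- The spectrum of an unbounded operator `A`: the complement of the set of all `z ∈ ℂ` for which
`A - z : dom A → H` has a bounded everywhere defined two-sided inverse. -/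
def unboundedSpectrum (A : H →ₗ.[ℂ] H) : Set ℂ :=
  {z | ∃ R : H →L[ℂ] H, (∀ x : A.domain, R (A x - z • (x : H)) = x) ∧
    ∀ y : H, ∃ x : A.domain, (x : H) = R y ∧ A x - z • (x : H) = y}ᶜ

/-- The eigenspace `{ψ ∈ dom A | A ψ = z ψ}` of an unbounded operator. -/
def unboundedEigenspace (A : H →ₗ.[ℂ] H) (z : ℂ) : Submodule ℂ H where
  carrier := {ψ | ∃ h : ψ ∈ A.domain, A ⟨ψ, h⟩ = z • ψ}
  add_mem' := by
    rintro x y ⟨hx, hx'⟩ ⟨hy, hy'⟩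
    refine ⟨A.domain.add_mem hx hy, ?_⟩
    rw [smul_add, ← hx', ← hy', ← A.map_add]
    rfl
  zero_mem' := ⟨A.domain.zero_mem, by rw [smul_zero]; exact A.map_zero⟩
  smul_mem' := by
    rintro c x ⟨hx, hx'⟩
    refine ⟨A.domain.smul_mem c hx, ?_⟩
    rw [smul_comm, ← hx', ← A.map_smul]
    rfl

/-- The half-line `[0, ∞)` as a subset of `ℂ`. -/
def nonnegHalfLine : Set ℂ := (fun r : ℝ => (r : ℂ)) '' Set.Ici 0

namespace BargmannGroup

variable [CompleteSpace H]

/-- Strong continuity of a unitary representation of the Bargmann group. -/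
def StronglyContinuous (U : BargmannGroup →* unitary (H →L[ℂ] H)) : Prop :=
  ∀ ψ : H, Continuous fun g => (U g : H →L[ℂ] H) ψ

/-- The energy operator: the generator of the time translations, `U(τ) = exp (i τ H)`, so that
`U(τ) B U(τ)⁻¹` is the observable `B` translated by `τ` in time. -/
def hamiltonian (U : BargmannGroup →* unitary (H →L[ℂ] H)) : H →ₗ.[ℂ] H :=
  infinitesimalGenerator fun τ => (U (timeTranslation τ) : H →L[ℂ] H)

/-- The mass operator: the generator of the central subgroup, `U(θ) = exp (i θ M)`. -/
def massOperator (U : BargmannGroup →* unitary (H →L[ℂ] H)) : H →ₗ.[ℂ] H :=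
  infinitesimalGenerator fun θ => (U (central θ) : H →L[ℂ] H)

/-- The mass sector `H_M`: the eigenspace of the mass operator for the value `M`. -/
def massSector (U : BargmannGroup →* unitary (H →L[ℂ] H)) (M : ℝ) : Submodule ℂ H :=
  unboundedEigenspace (massOperator U) M

/-- The Hilbert space is the Hilbert direct sum of the mass sectors. -/
def HasMassDecomposition (U : BargmannGroup →* unitary (H →L[ℂ] H)) : Prop :=
  IsHilbertSum ℂ (fun M : ℝ => massSector U M) fun M => (massSector U M).subtypeₗᵢ

end BargmannGroup

end

/-! A boost by `-b` maps a state of mass `M` to one whose mean energy is `E + b P + b² M ‖x‖² / 2`,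
with `E` and `P` the unnormalised means of energy and momentum in the original state `x`
(`boosted_energy_nonneg`). If the energy spectrum lies in `[0, ∞)`, this is nonnegative for every
`b`. Adding the inequalities for `b` and `-b` removes `P`, and a large `b` rules out `M < 0`.

Two analytic points support this. A nonzero mass sector contains a nonzero vector in the domains of
both energy and momentum, obtained by averaging over translations
(`exists_differentiable_mem_massSector`). Also, the spectral condition yields nonnegative
expectation values without the spectral theorem for unbounded operators, by passing to bounded
resolvents (`re_inner_nonneg_of_unboundedSpectrum_subset`).

For the equivalence, a nonzero sector puts `M` in the spectrum. Conversely, for `z` outside `[0,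
∞)`, the diagonal operator `(M - z)⁻¹` on the Hilbert sum is bounded and is the resolvent
(`IsUnitaryGroup.unboundedSpectrum_subset_nonnegHalfLine`). -/

open scoped InnerProductSpace
open Filter Topology

/-! ### Strongly continuous one-parameter groups and their time averages. -/

section OneParameterGroup

variable {H : Type*} [NormedAddCommGroup H] [InnerProductSpace ℂ H]

/-- A strongly continuous one-parameter group of isometries. -/
structure IsUnitaryGroup (u : ℝ → H →L[ℂ] H) : Prop where
  zero_apply : ∀ x, u 0 x = x
  add_apply : ∀ s t x, u (s + t) x = u s (u t x)
  inner_map_map : ∀ t x y, ⟪u t x, u t y⟫_ℂ = ⟪x, y⟫_ℂ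
  continuous_apply : ∀ x, Continuous fun t => u t x

namespace IsUnitaryGroup

variable {u : ℝ → H →L[ℂ] H}

theorem norm_map (hu : IsUnitaryGroup u) (t : ℝ) (x : H) : ‖u t x‖ = ‖x‖ := by
  rw [norm_eq_sqrt_re_inner (𝕜 := ℂ), hu.inner_map_map, ← norm_eq_sqrt_re_inner]

/-- The derivative of an orbit at an arbitrary time. -/
theorem hasDerivAt (hu : IsUnitaryGroup u) {x x' : H}
    (hx : HasDerivAt (fun t => u t x) x' 0) (t : ℝ) :
    HasDerivAt (fun s => u s x) (u t x') t := by
  have h1 : HasDerivAt (fun s => u (s - t) x) x' t := by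
    have := HasDerivAt.comp_sub_const (f := fun t => u t x) (f' := x') t t (by simpa using hx)
    simpa using this
  have h2 := ((u t).restrictScalars ℝ).hasFDerivAt.comp_hasDerivAt t h1
  refine h2.congr_of_eventuallyEq (Eventually.of_forall fun s => ?_)
  simp [← hu.add_apply]

/-- Differentiate the constant function `⟪u t x, u t y⟫` at `0`. This is the source of the symmetry
of the generator. -/
theorem inner_deriv_left (hu : IsUnitaryGroup u) {x x' y y' : H}
    (hx : HasDerivAt (fun t => u t x) x' 0) (hy : HasDerivAt (fun t => u t y) y' 0) :
    ⟪x', y⟫_ℂ = -⟪x, y'⟫_ℂ := by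
  have h := hx.inner ℂ hy
  simp only [hu.inner_map_map, hu.zero_apply] at h
  have := h.unique (hasDerivAt_const 0 _)
  rw [add_comm] at this
  exact eq_neg_of_add_eq_zero_left this

/-- An eigenvector of the generator spans an invariant line. -/
theorem apply_eq_exp_smul (hu : IsUnitaryGroup u) {x : H} {z : ℂ}
    (hx : HasDerivAt (fun t => u t x) ((Complex.I * z) • x) 0) (t : ℝ) :
    u t x = Complex.exp (Complex.I * z * t) • x := by
  have hexp : ∀ s : ℝ, HasDerivAt (fun s : ℝ => Complex.exp (-(Complex.I * z * s)))
      (Complex.exp (-(Complex.I * z * s)) * -(Complex.I * z)) s := by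
    intro s
    have h : HasDerivAt (fun s : ℝ => -(Complex.I * z * (s : ℂ))) (-(Complex.I * z)) s := by
      simpa using ((Complex.ofRealCLM.hasDerivAt (x := s)).const_mul (Complex.I * z)).fun_neg
    exact h.cexp
  have hd : ∀ s : ℝ, HasDerivAt (fun s : ℝ => Complex.exp (-(Complex.I * z * s)) • u s x) 0 s := by
    intro s
    have := (hexp s).smul (hu.hasDerivAt hx s)
    convert! this using 1
    rw [map_smul, smul_smul, ← add_smul]
    simp
  have hc := is_const_of_deriv_eq_zero (fun s => (hd s).differentiableAt)
    (fun s => (hd s).deriv) t 0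
  simp only [hu.zero_apply] at hc
  have h2 := congrArg (fun y => Complex.exp (Complex.I * z * t) • y) hc
  simpa [smul_smul, ← Complex.exp_add] using h2

theorem hasDerivAt_of_apply_eq_exp_smul {x : H} {z : ℂ}
    (hx : ∀ t : ℝ, u t x = Complex.exp (Complex.I * z * t) • x) :
    HasDerivAt (fun t => u t x) ((Complex.I * z) • x) 0 := by
  simp only [hx]
  have h : HasDerivAt (fun s : ℝ => (Complex.I * z * (s : ℂ))) (Complex.I * z) 0 := by
    simpa using (Complex.ofRealCLM.hasDerivAt (x := (0 : ℝ))).const_mul (Complex.I * z)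
  simpa using h.cexp.smul_const x

/-- A product of two commuting orbits is differentiable where its factors are. -/
theorem hasDerivAt_comp (hu : IsUnitaryGroup u) {c : ℝ → H} {x x' c' : H} (hc0 : c 0 = x)
    (hx : HasDerivAt (fun t => u t x) x' 0) (hc : HasDerivAt c c' 0) :
    HasDerivAt (fun t => u t (c t)) (x' + c') 0 := by
  rw [hasDerivAt_iff_tendsto_slope_zero] at *
  simp only [zero_add, hu.zero_apply, hc0] at *
  -- Only strong continuity is available, so `c'` is split off: `u t c'` converges strongly, and the
  -- isometry `u t` preserves the norm of the vanishing remainder.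
  have h3 : Tendsto (fun t : ℝ => u t (t⁻¹ • (c t - x))) (𝓝[≠] 0) (𝓝 c') := by
    have h4 : Tendsto (fun t : ℝ => u t c') (𝓝[≠] 0) (𝓝 c') := by
      simpa [hu.zero_apply] using
        ((hu.continuous_apply c').tendsto 0).mono_left nhdsWithin_le_nhds
    have h5 : Tendsto (fun t : ℝ => u t (t⁻¹ • (c t - x) - c')) (𝓝[≠] 0) (𝓝 0) := by
      rw [tendsto_zero_iff_norm_tendsto_zero]
      simp only [hu.norm_map]
      rw [← tendsto_zero_iff_norm_tendsto_zero]
      simpa using hc.sub_const c'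
    simpa [map_sub] using h5.add h4
  refine (hx.add h3).congr fun t => ?_
  have : u t (t⁻¹ • (c t - x)) = t⁻¹ • (u t (c t) - u t x) := by
    rw [← map_sub]
    exact ((u t).restrictScalars ℝ).map_smul _ _
  rw [this, ← smul_add]
  congr 1
  abel

/-- The weighted integral `∫ s in 0..r, f s • u s` of a one-parameter group. -/
noncomputable def orbitIntegral (hu : IsUnitaryGroup u) {f : ℝ → ℂ} (hf : Continuous f) (r : ℝ) :
    H →L[ℂ] H :=
  LinearMap.mkContinuous
    { toFun := fun x => ∫ s in (0 : ℝ)..r, f s • u s x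
      map_add' := fun x y => by
        simp only [map_add, smul_add]
        exact intervalIntegral.integral_add
          ((hf.smul (hu.continuous_apply x)).intervalIntegrable _ _)
          ((hf.smul (hu.continuous_apply y)).intervalIntegrable _ _)
      map_smul' := fun c x => by
        simp only [map_smul, RingHom.id_apply, smul_comm _ c]
        exact intervalIntegral.integral_smul _ _ }
    |∫ s in (0 : ℝ)..r, ‖f s‖| fun x => by
      refine intervalIntegral.norm_integral_le_abs_integral_norm.trans ?_
      simp only [norm_smul, hu.norm_map]
      rw [intervalIntegral.integral_mul_const, abs_mul, abs_norm]

theorem orbitIntegral_apply (hu : IsUnitaryGroup u) {f : ℝ → ℂ} (hf : Continuous f) (r : ℝ)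
    (x : H) : hu.orbitIntegral hf r x = ∫ s in (0 : ℝ)..r, f s • u s x := rfl

/-- The time average `∫ s in 0..r, u s` of a one-parameter group. -/
noncomputable def average (hu : IsUnitaryGroup u) (r : ℝ) : H →L[ℂ] H :=
  hu.orbitIntegral (continuous_const (y := 1)) r

theorem average_apply (hu : IsUnitaryGroup u) (r : ℝ) (x : H) :
    hu.average r x = ∫ s in (0 : ℝ)..r, u s x := by
  simp [average, orbitIntegral_apply]

variable [CompleteSpace H]

theorem average_comm (hu : IsUnitaryGroup u) {T : H →L[ℂ] H}
    (hT : ∀ s x, T (u s x) = u s (T x)) (r : ℝ) (x : H) :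
    T (hu.average r x) = hu.average r (T x) := by
  rw [average_apply, average_apply, ← ContinuousLinearMap.intervalIntegral_comp_comm _
    ((hu.continuous_apply x).intervalIntegrable _ _)]
  simp only [hT]

/-- Applying `u t` only shifts the window of integration to `[t, t + r]`, so the orbit is
differentiable even when that of `x` is not. -/
theorem hasDerivAt_average (hu : IsUnitaryGroup u) (r : ℝ) (x : H) :
    HasDerivAt (fun t => u t (hu.average r x)) (u r x - x) 0 := by
  have hint : ∀ a b : ℝ, IntervalIntegrable (fun s => u s x) MeasureTheory.volume a b :=
    fun a b => (hu.continuous_apply x).intervalIntegrable a b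
  have heq : ∀ t, u t (hu.average r x) =
      (∫ s in (0 : ℝ)..(t + r), u s x) - ∫ s in (0 : ℝ)..t, u s x := by
    intro t
    rw [average_apply, ← ContinuousLinearMap.intervalIntegral_comp_comm _ (hint 0 r)]
    simp only [← hu.add_apply]
    rw [intervalIntegral.integral_comp_add_left (fun s => u s x) t, add_zero,
      intervalIntegral.integral_interval_sub_left (hint _ _) (hint _ _)]
  simp only [heq]
  have hd : ∀ b : ℝ, HasDerivAt (fun t => ∫ s in (0 : ℝ)..t, u s x) (u b x) b := fun b =>
    ((hu.continuous_apply x).integral_hasStrictDerivAt 0 b).hasDerivAt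
  have h1 : HasDerivAt (fun t => ∫ s in (0 : ℝ)..(t + r), u s x) (u r x) 0 :=
    HasDerivAt.comp_add_const (f := fun t => ∫ s in (0 : ℝ)..t, u s x) 0 r
      (by simpa using hd r)
  simpa [hu.zero_apply] using h1.fun_sub (hd 0)

/-- The derivative of the average in `r` at `0` is `x`, so the averages cannot all vanish. -/
theorem exists_average_ne_zero (hu : IsUnitaryGroup u) {x : H} (hx : x ≠ 0) :
    ∃ r, hu.average r x ≠ 0 := by
  by_contra! h
  have h1 : HasDerivAt (fun t => ∫ s in (0 : ℝ)..t, u s x) (u 0 x) 0 :=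
    ((hu.continuous_apply x).integral_hasStrictDerivAt 0 0).hasDerivAt
  have h2 : (fun t => ∫ s in (0 : ℝ)..t, u s x) = fun _ => 0 :=
    funext fun r => (hu.average_apply r x).symm.trans (h r)
  rw [h2, hu.zero_apply] at h1
  exact hx (h1.unique (hasDerivAt_const 0 _))

end IsUnitaryGroup

end OneParameterGroup

/-! ### Spectrum and positivity of symmetric unbounded operators. -/

section UnboundedOperator

variable {H : Type*} [NormedAddCommGroup H] [InnerProductSpace ℂ H]

theorem exists_resolvent_of_notMem_unboundedSpectrum {A : H →ₗ.[ℂ] H} {z : ℂ}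
    (hz : z ∉ unboundedSpectrum A) :
    ∃ R : H →L[ℂ] H, (∀ x : A.domain, R (A x - z • (x : H)) = x) ∧
      ∀ y : H, ∃ x : A.domain, (x : H) = R y ∧ A x - z • (x : H) = y :=
  not_not.1 hz

theorem mem_unboundedSpectrum_of_mem_unboundedEigenspace {A : H →ₗ.[ℂ] H} {z : ℂ} {x : H}
    (hx : x ∈ unboundedEigenspace A z) (hx0 : x ≠ 0) : z ∈ unboundedSpectrum A := by
  by_contra hz
  obtain ⟨R, hR, -⟩ := exists_resolvent_of_notMem_unboundedSpectrum hz
  obtain ⟨hd, hA⟩ := hx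
  refine hx0 ?_
  have := hR ⟨x, hd⟩
  rw [hA, sub_self, map_zero] at this
  exact this.symm

theorem exists_resolvent_of_pos {A : H →ₗ.[ℂ] H}
    (hs : unboundedSpectrum A ⊆ nonnegHalfLine) {c : ℝ} (hc : 0 < c) :
    ∃ R : H →L[ℂ] H, (∀ x : A.domain, R (A x + (c : ℂ) • (x : H)) = x) ∧
      ∀ y : H, ∃ x : A.domain, (x : H) = R y ∧ A x + (c : ℂ) • (x : H) = y := by
  have hz : (-c : ℂ) ∉ unboundedSpectrum A := by
    intro h
    obtain ⟨r, hr, hrc⟩ := hs h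
    have : r = -c := Complex.ofReal_injective (by simpa using hrc)
    rw [Set.mem_Ici] at hr
    linarith
  simpa only [neg_smul, sub_neg_eq_add] using exists_resolvent_of_notMem_unboundedSpectrum hz

/-- A symmetric operator whose spectrum lies in `[0, ∞)` is nonnegative. -/
theorem re_inner_nonneg_of_unboundedSpectrum_subset [CompleteSpace H] {A : H →ₗ.[ℂ] H}
    (hA : ∀ x y : A.domain, ⟪A x, (y : H)⟫_ℂ = ⟪(x : H), A y⟫_ℂ)
    (hs : unboundedSpectrum A ⊆ nonnegHalfLine) (x : A.domain) :
    0 ≤ (⟪(x : H), A x⟫_ℂ).re := by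
  have key : ∀ c : ℝ, 0 < c → 0 ≤ (⟪(x : H), A x + (c : ℂ) • (x : H)⟫_ℂ).re := by
    intro c hc
    obtain ⟨R, hR, hR'⟩ := exists_resolvent_of_pos hs hc
    have hsymm : IsSelfAdjoint R := by
      rw [ContinuousLinearMap.isSelfAdjoint_iff_isSymmetric]
      intro y y'
      obtain ⟨w, hw, hwy⟩ := hR' y
      obtain ⟨w', hw', hwy'⟩ := hR' y'
      change ⟪R y, y'⟫_ℂ = ⟪y, R y'⟫_ℂ
      rw [← hw, ← hw', ← hwy, ← hwy', inner_add_left, inner_add_right, hA, inner_smul_left,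
        inner_smul_right, Complex.conj_ofReal]
    have hpos : 0 ≤ R := by
      rw [StarOrderedRing.nonneg_iff_spectrum_nonneg (R := ℝ) R hsymm]
      intro μ hμ
      by_contra! hneg
      refine hμ ?_
      -- For `μ < 0` and `R = (A + c)⁻¹`, formally `μ - R = μ (A + c - μ⁻¹) R`. As `c - μ⁻¹ > 0`,
      -- the middle factor has a bounded inverse `S`.
      obtain ⟨S, hS, hS'⟩ := exists_resolvent_of_pos hs
        (show 0 < c - μ⁻¹ by linarith [inv_lt_zero.2 hneg])
      have hμ0 : (μ : ℂ) ≠ 0 := by exact_mod_cast hneg.ne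
      have halg : algebraMap ℝ (H →L[ℂ] H) μ = (μ : ℂ) • 1 := by
        ext y
        simp [Algebra.algebraMap_eq_smul_one]
      have h1 : ∀ y, R y = S y - (μ : ℂ)⁻¹ • R (S y) := by
        intro y
        obtain ⟨w, hw, hwy⟩ := hS' y
        have := hR w
        rw [← hw, ← map_smul, ← hwy]
        nth_rewrite 2 [← this]
        rw [← map_sub]
        congr 1
        push_cast
        module
      have h2 : ∀ y, R y = S y - (μ : ℂ)⁻¹ • S (R y) := by
        intro y
        obtain ⟨w, hw, hwy⟩ := hR' y
        have := hS w
        rw [← hw, ← map_smul, ← hwy]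
        nth_rewrite 1 [← this]
        rw [← map_sub]
        congr 1
        push_cast
        module
      -- The candidate inverse is `μ⁻¹ (A + c) S`, rewritten with `(A + c) S = 1 + μ⁻¹ S`. The two
      -- orders of the resolvent identity check its two sides.
      refine isUnit_iff_exists.2 ⟨(μ : ℂ)⁻¹ • (1 + (μ : ℂ)⁻¹ • S), ?_, ?_⟩
      · ext y
        simp only [halg, _root_.mul_apply_eq_comp,
          _root_.sub_apply, _root_.smul_apply,
          _root_.add_apply, _root_.one_apply_eq_self, map_smul, map_add]
        rw [h1 y]
        match_scalars <;> field_simp <;> ring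
      · ext y
        simp only [halg, _root_.mul_apply_eq_comp,
          _root_.sub_apply, _root_.smul_apply,
          _root_.add_apply, _root_.one_apply_eq_self, map_smul, map_sub]
        nth_rewrite 1 [h2 y]
        match_scalars <;> field_simp <;> ring
    have := ((ContinuousLinearMap.nonneg_iff_isPositive R).1 hpos).re_inner_nonneg_left
      (A x + (c : ℂ) • (x : H))
    rwa [hR x] at this
  by_contra! h
  by_cases hx : (x : H) = 0
  · simp [hx] at h
  have hn : 0 < ‖(x : H)‖ ^ 2 := by positivity
  -- For this `c`, adding `c ‖x‖²` only halves the negative expectation value, contradicting `key`.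
  have hc : 0 < -(⟪(x : H), A x⟫_ℂ).re / (2 * ‖(x : H)‖ ^ 2) := by
    apply div_pos <;> linarith
  have := key _ hc
  rw [inner_add_right, inner_smul_right, Complex.add_re, inner_self_eq_norm_sq_to_K,
    Complex.re_ofReal_mul] at this
  have h3 : (((‖(x : H)‖ : ℂ)) ^ 2).re = ‖(x : H)‖ ^ 2 := by norm_cast
  simp only [Complex.coe_algebraMap] at this
  rw [h3] at this
  field_simp at this
  linarith

end UnboundedOperator

/-! ### Eigenvectors, symmetry and resolvents of generators. -/

section Generator

variable {H : Type*} [NormedAddCommGroup H] [InnerProductSpace ℂ H] {u : ℝ → H →L[ℂ] H}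

theorem infinitesimalGenerator_hasDerivAt (x : (infinitesimalGenerator u).domain) :
    HasDerivAt (fun t => u t (x : H)) (Complex.I • infinitesimalGenerator u x) 0 := by
  have hx : DifferentiableAt ℝ (fun t => u t (x : H)) 0 := x.2
  have : Complex.I • infinitesimalGenerator u x = deriv (fun t => u t (x : H)) 0 := by
    change Complex.I • (-Complex.I • deriv (fun t => u t (x : H)) 0) = _
    simp [smul_smul]
  rw [this]
  exact hx.hasDerivAt

theorem infinitesimalGenerator_apply {x x' : H} (hx : HasDerivAt (fun t => u t x) x' 0) :
    infinitesimalGenerator u ⟨x, hx.differentiableAt⟩ = -Complex.I • x' :=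
  congrArg (-Complex.I • ·) hx.deriv

theorem mem_unboundedEigenspace_infinitesimalGenerator {x : H} {z : ℂ} :
    x ∈ unboundedEigenspace (infinitesimalGenerator u) z ↔
      HasDerivAt (fun t => u t x) ((Complex.I * z) • x) 0 := by
  constructor
  · rintro ⟨hd, hx⟩
    have := infinitesimalGenerator_hasDerivAt ⟨x, hd⟩
    rwa [hx, smul_smul] at this
  · intro h
    refine ⟨h.differentiableAt, ?_⟩
    rw [infinitesimalGenerator_apply h, smul_smul]
    congr 1
    rw [← mul_assoc]
    simp

namespace IsUnitaryGroup

/-- This replaces an equation with domain conditions by one between bounded operators, which passes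
through commuting operators and integrals. -/
theorem mem_unboundedEigenspace_iff (hu : IsUnitaryGroup u) {x : H} {z : ℂ} :
    x ∈ unboundedEigenspace (infinitesimalGenerator u) z ↔
      ∀ t : ℝ, u t x = Complex.exp (Complex.I * z * t) • x := by
  rw [mem_unboundedEigenspace_infinitesimalGenerator]
  exact ⟨hu.apply_eq_exp_smul, hasDerivAt_of_apply_eq_exp_smul⟩

theorem infinitesimalGenerator_symmetric (hu : IsUnitaryGroup u)
    (x y : (infinitesimalGenerator u).domain) :
    ⟪infinitesimalGenerator u x, (y : H)⟫_ℂ = ⟪(x : H), infinitesimalGenerator u y⟫_ℂ := by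
  have h := hu.inner_deriv_left (infinitesimalGenerator_hasDerivAt x)
    (infinitesimalGenerator_hasDerivAt y)
  rw [inner_smul_left, inner_smul_right, Complex.conj_I, neg_mul, neg_inj] at h
  exact mul_left_cancel₀ Complex.I_ne_zero h

theorem re_inner_nonneg [CompleteSpace H] (hu : IsUnitaryGroup u)
    (hs : unboundedSpectrum (infinitesimalGenerator u) ⊆ nonnegHalfLine) {x x' : H}
    (hx : HasDerivAt (fun t => u t x) x' 0) : 0 ≤ (⟪x, -Complex.I • x'⟫_ℂ).re := by
  have := re_inner_nonneg_of_unboundedSpectrum_subset hu.infinitesimalGenerator_symmetric hs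
    ⟨x, hx.differentiableAt⟩
  rwa [infinitesimalGenerator_apply hx] at this

/-- A bounded operator that commutes with `u` and satisfies the integrated resolvent equation is
the resolvent of the generator. -/
theorem notMem_unboundedSpectrum [CompleteSpace H] (hu : IsUnitaryGroup u) {z : ℂ}
    {R : H →L[ℂ] H} (hcomm : ∀ t x, R (u t x) = u t (R x))
    (hR : ∀ t : ℝ, ∀ y, u t (R y) = Complex.exp (Complex.I * z * t) •
      (R y + Complex.I • ∫ s in (0 : ℝ)..t, Complex.exp (-(Complex.I * z * s)) • u s y)) :
    z ∉ unboundedSpectrum (infinitesimalGenerator u) := by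
  -- Differentiating the integrated equation at `0` gives both `R y ∈ dom A` and `(A - z) R y = y`.
  have hd : ∀ y, HasDerivAt (fun t => u t (R y)) ((Complex.I * z) • R y + Complex.I • y) 0 := by
    intro y
    simp only [hR _ y]
    have h1 : HasDerivAt (fun s : ℝ => Complex.exp (Complex.I * z * (s : ℂ))) (Complex.I * z) 0 := by
      have h : HasDerivAt (fun s : ℝ => (Complex.I * z * (s : ℂ))) (Complex.I * z) 0 := by
        simpa using (Complex.ofRealCLM.hasDerivAt (x := (0 : ℝ))).const_mul (Complex.I * z)
      simpa using h.cexp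
    have hc : Continuous fun s : ℝ => Complex.exp (-(Complex.I * z * s)) • u s y := by
      have := hu.continuous_apply y
      fun_prop
    have h2 := ((hc.integral_hasStrictDerivAt 0 0).hasDerivAt.fun_const_smul Complex.I).const_add
      (R y)
    have h3 := h1.fun_smul h2
    simpa [hu.zero_apply, add_comm] using h3
  refine not_not.2 ⟨R, fun x => ?_, fun y => ⟨⟨R y, (hd y).differentiableAt⟩, rfl, ?_⟩⟩
  · have h1 := infinitesimalGenerator_hasDerivAt x
    have h2 := (R.restrictScalars ℝ).hasFDerivAt.comp_hasDerivAt (0 : ℝ) h1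
    have h3 : HasDerivAt (fun t => u t (R (x : H))) (R (Complex.I • infinitesimalGenerator u x)) 0 :=
      h2.congr_of_eventuallyEq (Eventually.of_forall fun t => (hcomm t x).symm)
    have h4 := h3.unique (hd x)
    rw [map_sub, map_smul]
    rw [map_smul, mul_smul, ← smul_add] at h4
    have h5 := smul_right_injective H Complex.I_ne_zero h4
    rw [h5]
    abel
  · rw [infinitesimalGenerator_apply (hd y)]
    match_scalars <;> simp [← mul_assoc]

end IsUnitaryGroup

end Generator

theorem isClosed_nonnegHalfLine : IsClosed nonnegHalfLine :=
  Complex.isometry_ofReal.isClosedEmbedding.isClosedMap _ isClosed_Ici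

/-- The half-line is closed. The bound is uniform in `r`, which makes the diagonal resolvent
bounded. -/
theorem exists_le_norm_sub_of_notMem_nonnegHalfLine {z : ℂ} (hz : z ∉ nonnegHalfLine) :
    ∃ d > 0, ∀ r : ℝ, 0 ≤ r → d ≤ ‖(r : ℂ) - z‖ := by
  obtain ⟨d, hd, hball⟩ := Metric.isOpen_iff.1 isClosed_nonnegHalfLine.isOpen_compl z hz
  refine ⟨d, hd, fun r hr => ?_⟩
  by_contra! h
  exact hball (show (r : ℂ) ∈ Metric.ball z d by rwa [mem_ball_iff_norm]) ⟨r, hr, rfl⟩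

/-! ### Diagonal operators on a Hilbert sum of eigenspaces. -/

section HilbertSum

variable {H : Type*} [NormedAddCommGroup H] [InnerProductSpace ℂ H] [CompleteSpace H]
  {ι : Type*} {F : ι → Submodule ℂ H}

/-- Two bounded operators that agree on the summands of a Hilbert sum are equal. -/
theorem IsHilbertSum.clm_ext
    (hF : IsHilbertSum ℂ (fun i => F i) fun i => (F i).subtypeₗᵢ) {S T : H →L[ℂ] H}
    (h : ∀ i, ∀ x ∈ F i, S x = T x) : S = T := by
  ext y
  have hy := hF.hasSum_linearIsometryEquiv_symm (hF.linearIsometryEquiv y)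
  rw [LinearIsometryEquiv.symm_apply_apply] at hy
  refine (S.hasSum hy).unique ?_
  convert T.hasSum hy using 2 with i
  exact h i _ (hF.linearIsometryEquiv y i).2

/-- A bounded family of scalars defines a bounded diagonal operator on a Hilbert sum. -/
theorem IsHilbertSum.exists_diagonal
    (hF : IsHilbertSum ℂ (fun i => F i) fun i => (F i).subtypeₗᵢ) {c : ι → ℂ} {K : ℝ}
    (hK : 0 ≤ K) (hc : ∀ i, ‖c i‖ ≤ K) :
    ∃ R : H →L[ℂ] H, ∀ i, ∀ x ∈ F i, R x = c i • x := by
  classical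
  have hT : ∀ i, ‖c i • ContinuousLinearMap.id ℂ (F i)‖ ≤ K := fun i =>
    ContinuousLinearMap.opNorm_le_bound _ hK fun x => by
      simpa [norm_smul] using mul_le_mul_of_nonneg_right (hc i) (norm_nonneg x)
  let e := hF.linearIsometryEquiv
  refine ⟨(e.symm.toContinuousLinearEquiv : lp (fun i => F i) 2 →L[ℂ] H) ∘L
    lp.mapCLM 2 (fun i => c i • ContinuousLinearMap.id ℂ (F i)) hK hT ∘L
      (e.toContinuousLinearEquiv : H →L[ℂ] lp (fun i => F i) 2), fun i x hx => ?_⟩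
  have h1 : e x = lp.single 2 i (⟨x, hx⟩ : F i) := by
    rw [← e.symm.injective.eq_iff, e.symm_apply_apply]
    exact (hF.linearIsometryEquiv_symm_apply_single (⟨x, hx⟩ : F i)).symm
  have h2 : lp.mapCLM 2 (fun i => c i • ContinuousLinearMap.id ℂ (F i)) hK hT (e x) =
      c i • e x := by
    rw [h1]
    ext j
    by_cases hj : j = i
    · subst hj
      simp
    · simp [hj]
  change e.symm (lp.mapCLM 2 _ hK hT (e x)) = _
  rw [h2, map_smul, e.symm_apply_apply]

variable {u : ℝ → H →L[ℂ] H}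

/-- If the eigenspaces of the generator span and those for negative eigenvalues vanish, then the
spectrum of the generator lies in `[0, ∞)`. -/
theorem IsUnitaryGroup.unboundedSpectrum_subset_nonnegHalfLine (hu : IsUnitaryGroup u)
    (hF : IsHilbertSum ℂ
      (fun M : ℝ => unboundedEigenspace (infinitesimalGenerator u) (M : ℂ))
      fun M => (unboundedEigenspace (infinitesimalGenerator u) (M : ℂ)).subtypeₗᵢ)
    (h0 : ∀ M : ℝ, M < 0 → unboundedEigenspace (infinitesimalGenerator u) (M : ℂ) = ⊥) :
    unboundedSpectrum (infinitesimalGenerator u) ⊆ nonnegHalfLine := by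
  intro z
  contrapose
  intro hz
  obtain ⟨d, hd, hle⟩ := exists_le_norm_sub_of_notMem_nonnegHalfLine hz
  -- Truncating at `0` makes the bound hold for every `M`; the values at `M < 0` do not matter,
  -- since those eigenspaces vanish.
  obtain ⟨R, hR⟩ := hF.exists_diagonal (c := fun M : ℝ => ((max M 0 : ℝ) - z : ℂ)⁻¹)
    (inv_nonneg.2 hd.le) fun M => by
      rw [norm_inv]
      exact inv_anti₀ hd (hle _ (le_max_right _ _))
  have hexp := fun (M : ℝ) x (hx : x ∈ unboundedEigenspace (infinitesimalGenerator u) (M : ℂ)) =>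
    hu.mem_unboundedEigenspace_iff.1 hx
  refine hu.notMem_unboundedSpectrum (R := R) (fun t x => ?_) fun t y => ?_
  · refine congrArg (fun T : H →L[ℂ] H => T x) (hF.clm_ext (S := R ∘L u t) (T := u t ∘L R) ?_)
    intro M x hx
    rw [ContinuousLinearMap.comp_apply, ContinuousLinearMap.comp_apply, hexp M x hx, hR M x hx,
      map_smul, map_smul, hexp M x hx, hR M x hx, smul_comm]
  · have hf : Continuous fun s : ℝ => Complex.exp (-(Complex.I * z * s)) := by fun_prop
    -- In integrated form the resolvent equation involves bounded operators only, so it suffices to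
    -- check it on eigenvectors.
    refine congrArg (fun T : H →L[ℂ] H => T y) (hF.clm_ext (S := u t ∘L R)
      (T := Complex.exp (Complex.I * z * t) • (R + Complex.I • hu.orbitIntegral hf t)) ?_)
    intro M x hx
    rcases lt_or_ge M 0 with hM | hM
    · have : x = 0 := by simpa [h0 M hM] using hx
      simp [this]
    have hMz : (M : ℂ) - z ≠ 0 := fun h => by
      have := hle M hM
      rw [h, norm_zero] at this
      linarith
    have hint : hu.orbitIntegral hf t x =
        ((Complex.exp (Complex.I * (M - z) * t) - 1) / (Complex.I * (M - z))) • x := by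
      have h1 : ∀ s : ℝ, Complex.exp (-(Complex.I * z * s)) • u s x =
          Complex.exp (Complex.I * (M - z) * s) • x := fun s => by
        rw [hexp M x hx, smul_smul, ← Complex.exp_add]
        congr 2
        ring
      rw [hu.orbitIntegral_apply]
      simp only [h1]
      rw [intervalIntegral.integral_smul_const,
        integral_exp_mul_complex (mul_ne_zero Complex.I_ne_zero hMz)]
      simp
    have hsplit : Complex.exp (Complex.I * M * t) =
        Complex.exp (Complex.I * z * t) * Complex.exp (Complex.I * (M - z) * t) := by
      rw [← Complex.exp_add]
      congr 1
      ring
    simp only [ContinuousLinearMap.comp_apply, _root_.smul_apply, _root_.add_apply, hR M x hx,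
      map_smul, hexp M x hx, hint, max_eq_left hM, hsplit, smul_smul, ← add_smul]
    congr 1
    field_simp [Complex.I_ne_zero]
    ring

end HilbertSum

/-! ### Boosts, translations and the positivity of mass. -/

namespace BargmannGroup

/-- The one-parameter group of translations along the first coordinate axis. -/
def axisTranslation (r : ℝ) : BargmannGroup :=
  { phase := 0, time := 0, trans := Pi.single 0 r, boost := 0, rot := 1 }

/-- The one-parameter group of boosts along the first coordinate axis. -/
def axisBoost (b : ℝ) : BargmannGroup :=
  { phase := 0, time := 0, trans := 0, boost := Pi.single 0 b, rot := 1 }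

theorem continuous_of_coords {c : ℝ → BargmannGroup}
    (h : Continuous fun t => ((c t).phase, (c t).time, (c t).trans, (c t).boost, (c t).rot)) :
    Continuous c :=
  continuous_induced_rng.2 h

theorem timeTranslation_mul_axisTranslation (t r : ℝ) :
    timeTranslation t * axisTranslation r = axisTranslation r * timeTranslation t := by
  ext1 <;> simp [-Matrix.mulVec_single, mul_def, timeTranslation, axisTranslation]

/-- Conjugating a time translation by a boost produces a central phase, a time translation and a
spatial translation. -/
theorem timeTranslation_mul_axisBoost (t b : ℝ) :
    timeTranslation t * axisBoost (-b) =
      axisBoost (-b) * (central (b ^ 2 / 2 * t) * (timeTranslation t * axisTranslation (t * b))) := by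
  ext1
  -- The phases cancel: `b² t / 2` from the central element, `-b² t` from the boost paired with the
  -- translation, and `b² t / 2` from the cocycle's time term.
  · simp [mul_def, timeTranslation, axisTranslation, axisBoost, central]
    ring
  · simp [mul_def, timeTranslation, axisTranslation, axisBoost, central]
  · ext i
    fin_cases i <;> simp [mul_def, timeTranslation, axisTranslation, axisBoost, central]
  · simp [-Matrix.mulVec_single, mul_def, timeTranslation, axisTranslation, axisBoost, central]
  · simp [mul_def, timeTranslation, axisTranslation, axisBoost, central]

section Representation

variable {H : Type*} [NormedAddCommGroup H] [InnerProductSpace ℂ H] [CompleteSpace H]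
  {U : BargmannGroup →* unitary (H →L[ℂ] H)}

theorem map_mul_apply (g h : BargmannGroup) (x : H) :
    (U (g * h) : H →L[ℂ] H) x = (U g : H →L[ℂ] H) ((U h : H →L[ℂ] H) x) := by
  rw [map_mul]
  rfl

theorem inner_map_map (g : BargmannGroup) (x y : H) :
    ⟪(U g : H →L[ℂ] H) x, (U g : H →L[ℂ] H) y⟫_ℂ = ⟪x, y⟫_ℂ :=
  ContinuousLinearMap.inner_map_map_of_mem_unitary (U g).2 x y

theorem isUnitaryGroup_comp (hU : StronglyContinuous U) {c : ℝ → BargmannGroup}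
    (hc : Continuous c) (h0 : c 0 = 1) (hadd : ∀ s t, c (s + t) = c s * c t) :
    IsUnitaryGroup fun t => (U (c t) : H →L[ℂ] H) where
  zero_apply x := by simp [h0]
  add_apply s t x := by rw [hadd, map_mul_apply]
  inner_map_map t := inner_map_map (c t)
  continuous_apply x := (hU x).comp hc

theorem isUnitaryGroup_central (hU : StronglyContinuous U) :
    IsUnitaryGroup fun t => (U (central t) : H →L[ℂ] H) := by
  refine isUnitaryGroup_comp hU (continuous_of_coords ?_) rfl fun s t => ?_
  · simp only [central]
    fun_prop
  · ext1 <;> simp [mul_def, central]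

theorem isUnitaryGroup_timeTranslation (hU : StronglyContinuous U) :
    IsUnitaryGroup fun t => (U (timeTranslation t) : H →L[ℂ] H) := by
  refine isUnitaryGroup_comp hU (continuous_of_coords ?_) rfl fun s t => ?_
  · simp only [timeTranslation]
    fun_prop
  · ext1 <;> simp [mul_def, timeTranslation]

theorem isUnitaryGroup_axisTranslation (hU : StronglyContinuous U) :
    IsUnitaryGroup fun t => (U (axisTranslation t) : H →L[ℂ] H) := by
  refine isUnitaryGroup_comp hU (continuous_of_coords ?_) ?_ fun s t => ?_
  · simp only [axisTranslation]
    have : Continuous fun t : ℝ => (Pi.single 0 t : Fin 3 → ℝ) := 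
      continuous_single (A := fun _ : Fin 3 => ℝ) 0
    fun_prop
  · simp [axisTranslation, one_def]
  · ext1 <;> simp [-Matrix.mulVec_single, mul_def, axisTranslation, Pi.single_add, add_comm]

/-- A nonzero mass sector contains a nonzero vector in the domains of the energy and of a momentum
component. -/
theorem exists_differentiable_mem_massSector (hU : StronglyContinuous U) {M : ℝ}
    (hM : massSector U M ≠ ⊥) :
    ∃ x ∈ massSector U M, x ≠ 0 ∧
      (∃ h, HasDerivAt (fun t => (U (timeTranslation t) : H →L[ℂ] H) x) h 0) ∧
        ∃ p, HasDerivAt (fun t => (U (axisTranslation t) : H →L[ℂ] H) x) p 0 := by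
  have hC := isUnitaryGroup_central hU
  have hT := isUnitaryGroup_timeTranslation hU
  have hA := isUnitaryGroup_axisTranslation hU
  obtain ⟨w, hw, hw0⟩ := Submodule.exists_mem_ne_zero_of_ne_bot hM
  -- Average over space, then over time, keeping the vector nonzero. The time average commutes with
  -- spatial translations, so it preserves the differentiability already gained.
  obtain ⟨r, hr⟩ := hA.exists_average_ne_zero hw0
  obtain ⟨s, hs⟩ := hT.exists_average_ne_zero hr
  refine ⟨_, ?_, hs, ⟨_, hT.hasDerivAt_average s _⟩, hT.average s ((U (axisTranslation r) : H →L[ℂ] H) w - w), ?_⟩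
  · refine hC.mem_unboundedEigenspace_iff.2 fun t => ?_
    rw [hT.average_comm (T := (U (central t) : H →L[ℂ] H)) (fun q x => by
        rw [← map_mul_apply, central_mul_comm, map_mul_apply]),
      hA.average_comm (T := (U (central t) : H →L[ℂ] H)) (fun q x => by
        rw [← map_mul_apply, central_mul_comm, map_mul_apply]),
      hC.mem_unboundedEigenspace_iff.1 hw t, map_smul, map_smul]
  · have h1 := ((hT.average s).restrictScalars ℝ).hasFDerivAt.comp_hasDerivAt (0 : ℝ)
      (hA.hasDerivAt_average r w)
    refine h1.congr_of_eventuallyEq (Eventually.of_forall fun t => ?_)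
    exact hT.average_comm (T := (U (axisTranslation t) : H →L[ℂ] H)) (fun q x => by
      rw [← map_mul_apply, ← timeTranslation_mul_axisTranslation, map_mul_apply]) s _

/-- The expectation value of the energy in a boosted state is nonnegative. -/
theorem boosted_energy_nonneg (hU : StronglyContinuous U)
    (hs : unboundedSpectrum (hamiltonian U) ⊆ nonnegHalfLine) {M : ℝ} {x h p : H}
    (hx : x ∈ massSector U M)
    (hh : HasDerivAt (fun t => (U (timeTranslation t) : H →L[ℂ] H) x) h 0)
    (hp : HasDerivAt (fun t => (U (axisTranslation t) : H →L[ℂ] H) x) p 0) (b : ℝ) :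
    0 ≤ b ^ 2 / 2 * M * ‖x‖ ^ 2 + (⟪x, -Complex.I • h⟫_ℂ).re +
      b * (⟪x, -Complex.I • p⟫_ℂ).re := by
  have hC := isUnitaryGroup_central hU
  have hT := isUnitaryGroup_timeTranslation hU
  have hA := isUnitaryGroup_axisTranslation hU
  let B := (U (axisBoost (-b)) : H →L[ℂ] H)
  have hp' : HasDerivAt (fun t => (U (axisTranslation (t * b)) : H →L[ℂ] H) x) (b • p) 0 := by
    have h1 : HasDerivAt (fun t : ℝ => t * b) b 0 := by
      simpa using (hasDerivAt_id (0 : ℝ)).mul_const b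
    exact HasDerivAt.scomp_of_eq (0 : ℝ) hp h1 (by simp)
  have h1 := hT.hasDerivAt_comp (by simpa using hA.zero_apply x) hh hp'
  have hc : HasDerivAt (fun t : ℝ => Complex.exp (Complex.I * M * ((b ^ 2 / 2 * t : ℝ) : ℂ)))
      (Complex.I * M * (b ^ 2 / 2)) 0 := by
    have h2 : HasDerivAt (fun t : ℝ => Complex.I * M * ((b ^ 2 / 2 * t : ℝ) : ℂ))
        (Complex.I * M * (b ^ 2 / 2)) 0 := by
      have := ((Complex.ofRealCLM.hasDerivAt (x := (0 : ℝ))).const_mul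
        (Complex.I * M * (b ^ 2 / 2)))
      simpa [mul_assoc] using this
    simpa using h2.cexp
  have h2 := (B.restrictScalars ℝ).hasFDerivAt.comp_hasDerivAt (0 : ℝ) (hc.fun_smul h1)
  have h3 : HasDerivAt (fun t => (U (timeTranslation t) : H →L[ℂ] H) (B x))
      (B ((h + b • p) + (Complex.I * M * (b ^ 2 / 2)) • x)) 0 := by
    have h4 : (U (timeTranslation 0) : H →L[ℂ] H) ((U (axisTranslation (0 * b)) : H →L[ℂ] H) x)
        = x := by
      rw [hT.zero_apply, zero_mul, hA.zero_apply]
    simp only [h4, mul_zero, Complex.ofReal_zero, Complex.exp_zero, one_smul] at h2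
    refine h2.congr_of_eventuallyEq (Eventually.of_forall fun t => ?_)
    change (U (timeTranslation t) : H →L[ℂ] H) ((U (axisBoost (-b)) : H →L[ℂ] H) x) = B (_ • _)
    -- The central element is moved to act first on `x`, where it is the scalar `exp (i M b² t /
    -- 2)`.
    rw [← map_mul_apply, timeTranslation_mul_axisBoost, central_mul_comm, map_mul_apply,
      map_mul_apply, hC.mem_unboundedEigenspace_iff.1 hx, map_smul, map_mul_apply]
  have h5 := hT.re_inner_nonneg hs h3
  -- The boost is unitary, so it drops out of the expectation value.
  rw [← map_smul, inner_map_map] at h5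
  have h6 : -Complex.I • ((h + b • p) + (Complex.I * M * (b ^ 2 / 2)) • x) =
      -Complex.I • h + (b : ℂ) • (-Complex.I • p) + ((M * (b ^ 2 / 2) : ℝ) : ℂ) • x := by
    rw [← Complex.coe_smul b p]
    match_scalars <;> simp [← mul_assoc]
    ring
  rw [h6, inner_add_right, inner_add_right, inner_smul_right (r := (b : ℂ)),
    inner_smul_right (r := ((M * (b ^ 2 / 2) : ℝ) : ℂ)), Complex.add_re, Complex.add_re,
    Complex.re_ofReal_mul, Complex.re_ofReal_mul, inner_self_eq_norm_sq_to_K] at h5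
  have h7 : (((‖x‖ : ℂ)) ^ 2).re = ‖x‖ ^ 2 := by norm_cast
  simp only [Complex.coe_algebraMap, h7] at h5
  linarith

/-- If the energy spectrum is nonnegative, then there are no states of negative mass. -/
theorem massSector_eq_bot_of_neg (hU : StronglyContinuous U)
    (hs : unboundedSpectrum (hamiltonian U) ⊆ nonnegHalfLine) {M : ℝ} (hM : M < 0) :
    massSector U M = ⊥ := by
  by_contra hne
  obtain ⟨x, hx, hx0, ⟨h, hh⟩, p, hp⟩ := exists_differentiable_mem_massSector hU hne
  have hE : ∀ b : ℝ, 0 ≤ b ^ 2 * (M * ‖x‖ ^ 2) + 2 * (⟪x, -Complex.I • h⟫_ℂ).re := by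
    intro b
    have h1 := boosted_energy_nonneg hU hs hx hh hp b
    have h2 := boosted_energy_nonneg hU hs hx hh hp (-b)
    linarith
  have hneg : M * ‖x‖ ^ 2 < 0 := mul_neg_of_neg_of_pos hM (by positivity)
  have h0 := hE 0
  set E := 2 * (⟪x, -Complex.I • h⟫_ℂ).re
  -- The case `b = 0` gives `E ≥ 0`, so the root is genuine. This `b` satisfies `b² M ‖x‖² = -(E +
  -- 1)`, which turns the inequality into `0 ≤ -1`.
  have h1 := hE √((E + 1) / -(M * ‖x‖ ^ 2))
  rw [Real.sq_sqrt (div_nonneg (by linarith) (by linarith)), div_neg, neg_mul,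
    div_mul_cancel₀ _ hneg.ne] at h1
  linarith

end Representation

end BargmannGroup

theorem mainTheorem5 {H : Type*} [NormedAddCommGroup H] [InnerProductSpace ℂ H] [CompleteSpace H]
    (U : BargmannGroup →* unitary (H →L[ℂ] H))
    (hU : BargmannGroup.StronglyContinuous U)
    (hM : BargmannGroup.HasMassDecomposition U) :
    (unboundedSpectrum (BargmannGroup.hamiltonian U) ⊆ nonnegHalfLine →
      unboundedSpectrum (BargmannGroup.massOperator U) ⊆ nonnegHalfLine ∧
        ∀ M : ℝ, M < 0 → BargmannGroup.massSector U M = ⊥) ∧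
    (unboundedSpectrum (BargmannGroup.massOperator U) ⊆ nonnegHalfLine ↔
      ∀ M : ℝ, M < 0 → BargmannGroup.massSector U M = ⊥) := by
  have hback : (∀ M : ℝ, M < 0 → BargmannGroup.massSector U M = ⊥) →
      unboundedSpectrum (BargmannGroup.massOperator U) ⊆ nonnegHalfLine :=
    (BargmannGroup.isUnitaryGroup_central hU).unboundedSpectrum_subset_nonnegHalfLine hM
  have hpos : unboundedSpectrum (BargmannGroup.hamiltonian U) ⊆ nonnegHalfLine →
      ∀ M : ℝ, M < 0 → BargmannGroup.massSector U M = ⊥ :=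
    fun hs _ => BargmannGroup.massSector_eq_bot_of_neg hU hs
  refine ⟨fun hs => ⟨hback (hpos hs), hpos hs⟩, fun hs M hneg => ?_, hback⟩
  by_contra hne
  obtain ⟨x, hx, hx0⟩ := Submodule.exists_mem_ne_zero_of_ne_bot hne
  -- A nonzero vector in the sector makes `M` an eigenvalue, hence a point of the spectrum.
  obtain ⟨r, hr, hrM⟩ := hs (mem_unboundedSpectrum_of_mem_unboundedEigenspace hx hx0)
  have : r = M := Complex.ofReal_injective hrM
  rw [Set.mem_Ici] at hr
  linarith
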